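/- Let $(\Omega,\Sigma,\mu)$ be a finite measure space, let $Z$ be a real Banach space, and let $X\subseteq Z^*$ be a norm-closed linear subspace which is norming for $Z$, i.e. $|||z|||=\sup\{\langle x,z\rangle : x\in X,\ \|x\|\le 1\}$ defines an equivalent norm on $Z$. Let $\sigma(Z,X)$ be the topology on $Z$ of pointwise convergence on $X$, and assume that $(Z,\sigma(Z,X))$ has the Mazur property, i.e. every $\sigma(Z,X)$-sequentially continuous linear functional $Z\to\mathbb{R}$ is $\sigma(Z,X)$-continuous. Let $\nu:\Sigma\to Z^*$ be a (norm) countably additive vector measure which is $\mu$-continuous, i.e. $\|\nu(A)\|\to 0$ as $\mu(A)\to 0$, and which satisfies $$ \overline{\mathrm{co}\Big\{\tfrac{\nu(B)}{\mu(B)} : B\in\Sigma,\ B\subseteq A,\ \mu(B)>0\Big\}}^{\,w^*}\cap X\neq\emptyset \quad\text{for every } A\in\Sigma \text{ with } \mu(A)>0. \tag{G} $$ Then $\nu(A)\in X$ for every $A\in\Sigma$. -/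

import Mathlib

open MeasureTheory

/-- The natural bilinear pairing `(z, x) ↦ ⟨x, z⟩ = x z` between a real Banach space `Z` and a
subspace `X` of its dual `Z*`. -/
def dualPairing {Z : Type*} [NormedAddCommGroup Z] [NormedSpace ℝ Z]
    (X : Submodule ℝ (StrongDual ℝ Z)) : Z →ₗ[ℝ] X →ₗ[ℝ] ℝ :=
  LinearMap.mk₂ ℝ (fun z x => (x : StrongDual ℝ Z) z)
    (fun z w x => map_add (x : StrongDual ℝ Z) z w)
    (fun c z x => map_smul (x : StrongDual ℝ Z) c z)
    (fun _ _ _ => rfl)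
    (fun _ _ _ => rfl)

/-- The quantity `|||z||| = sup {⟨x, z⟩ : x ∈ B_X}`, where `B_X` is the closed unit ball of `X`. -/
noncomputable def supNormOn {Z : Type*} [NormedAddCommGroup Z] [NormedSpace ℝ Z]
    (X : Submodule ℝ (StrongDual ℝ Z)) (z : Z) : ℝ :=
  sSup {t : ℝ | ∃ x ∈ X, ‖x‖ ≤ 1 ∧ t = x z}

/-- `X ⊆ Z*` is norming for `Z` if `|||z||| = sup {⟨x, z⟩ : x ∈ B_X}` is an equivalent norm on `Z`.
(The function `|||·|||` is always a seminorm, and the lower estimate makes it a norm.) -/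
def IsNorming {Z : Type*} [NormedAddCommGroup Z] [NormedSpace ℝ Z]
    (X : Submodule ℝ (StrongDual ℝ Z)) : Prop :=
  ∃ c : ℝ, 0 < c ∧ ∃ C : ℝ, 0 < C ∧ ∀ z : Z, c * ‖z‖ ≤ supNormOn X z ∧ supNormOn X z ≤ C * ‖z‖

/-- The Mazur property: every sequentially continuous linear functional is continuous. -/
def HasMazurProperty (E : Type*) [AddCommGroup E] [Module ℝ E] [TopologicalSpace E] : Prop :=
  ∀ φ : E →ₗ[ℝ] ℝ, SeqContinuous φ → Continuous φ

/-- A vector measure `ν` is `μ`-continuous if `‖ν A‖ → 0` as `μ A → 0`. -/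
def IsContinuousWrt {Ω : Type*} [MeasurableSpace Ω] {E : Type*} [NormedAddCommGroup E]
    (ν : VectorMeasure Ω E) (μ : Measure Ω) : Prop :=
  ∀ ε : ℝ, 0 < ε → ∃ δ : ℝ, 0 < δ ∧ ∀ A : Set Ω, MeasurableSet A → μ.real A < δ → ‖ν A‖ < ε

/-- The average range `{ν B / μ B : B ∈ Σ, B ⊆ A, μ B > 0}` of `ν` on `A`. -/
def averageRange {Ω : Type*} [MeasurableSpace Ω] {E : Type*} [NormedAddCommGroup E]
    [NormedSpace ℝ E] (ν : VectorMeasure Ω E) (μ : Measure Ω) (A : Set Ω) : Set E :=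
  {y | ∃ B : Set Ω, MeasurableSet B ∧ B ⊆ A ∧ 0 < μ B ∧ y = (μ.real B)⁻¹ • ν B}

/-- Condition (G): for every `A ∈ Σ` with `μ A > 0`, the weak* closure of the convex hull of the
average range of `ν` on `A` meets `X`. -/
def ConditionG {Ω : Type*} [MeasurableSpace Ω] {Z : Type*} [NormedAddCommGroup Z]
    [NormedSpace ℝ Z] (ν : VectorMeasure Ω (StrongDual ℝ Z)) (μ : Measure Ω)
    (X : Submodule ℝ (StrongDual ℝ Z)) : Prop :=
  ∀ A : Set Ω, MeasurableSet A → 0 < μ A →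
    ∃ x ∈ X, StrongDual.toWeakDual x ∈
      closure (StrongDual.toWeakDual '' (convexHull ℝ (averageRange ν μ A)))

open Filter Topology

/-! A functional continuous for σ(Z,X) is evaluation at an element of X, so by the Mazur property it
is enough that each `ν A` sends σ(Z,X)-null sequences `z n` to null sequences. Such sequences are
norm bounded by uniform boundedness on the Banach space X.

If `ν A (z n) ≥ ε` for all n, the scalar densities `T (z n)` of `ν` are bounded and uniformly
integrable in L¹, so some forward convex combinations `w n` have `T (w n)` norm convergent
(`exists_tendsto_of_antitone_convex`). The limit has integral at least ε over A. Along an a.e.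
convergent subsequence, `T (w n) ≥ δ > 0` for all large n on one set B of positive measure. Averages
of `ν` inside B are then at least δ at `w n`, and so is the point x of X given by (G) for B. But `x
(w n) → 0`, a contradiction (`ConditionG.not_forall_le`).

The convergent selection comes from almost minimising the strictly convex functional `integralSqrt`,
with no appeal to weak compactness. -/

/-- The convexity gap of `t ↦ √(1 + t²)` is nonnegative. -/
lemma sqrt_one_add_sq_gap_nonneg (a b : ℝ) :
    0 ≤ √(1 + a ^ 2) + √(1 + b ^ 2) - 2 * √(1 + ((1 / 2 : ℝ) * (a + b)) ^ 2) := by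
  have hu := Real.sq_sqrt (show (0 : ℝ) ≤ 1 + a ^ 2 by positivity)
  have hv := Real.sq_sqrt (show (0 : ℝ) ≤ 1 + b ^ 2 by positivity)
  have hs := Real.sq_sqrt (show (0 : ℝ) ≤ 1 + ((1 / 2 : ℝ) * (a + b)) ^ 2 by positivity)
  have hu0 := Real.sqrt_nonneg (1 + a ^ 2)
  have hv0 := Real.sqrt_nonneg (1 + b ^ 2)
  have hs0 := Real.sqrt_nonneg (1 + ((1 / 2 : ℝ) * (a + b)) ^ 2)
  set u := √(1 + a ^ 2)
  set v := √(1 + b ^ 2)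
  set s := √(1 + ((1 / 2 : ℝ) * (a + b)) ^ 2)
  have huv : 1 + a * b ≤ u * v := by
    refine le_of_abs_le (abs_le_of_sq_le_sq ?_ (by positivity))
    rw [mul_pow, hu, hv]
    nlinarith [sq_nonneg (a - b)]
  have : 2 * s ≤ u + v := by
    refine le_of_abs_le (abs_le_of_sq_le_sq ?_ (by positivity))
    nlinarith
  linarith

/-- A quantitative strict convexity estimate for `t ↦ √(1 + t²)` on `[-M, M]`. -/
lemma sq_sub_le_mul_sqrt_one_add_sq_gap {a b M : ℝ} (hM : 0 ≤ M) (ha : |a| ≤ M) (hb : |b| ≤ M) :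
    (a - b) ^ 2 ≤ 4 * (1 + M) ^ 3 *
      (√(1 + a ^ 2) + √(1 + b ^ 2) - 2 * √(1 + ((1 / 2 : ℝ) * (a + b)) ^ 2)) := by
  have hgap := sqrt_one_add_sq_gap_nonneg a b
  have bound : ∀ t : ℝ, |t| ≤ M → √(1 + t ^ 2) ≤ 1 + M := fun t ht => by
    rw [Real.sqrt_le_left (by positivity)]
    nlinarith [sq_abs t, abs_nonneg t]
  have ha' := bound a ha
  have hb' := bound b hb
  have hs' := bound ((1 / 2 : ℝ) * (a + b)) (by
    rw [abs_le] at *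
    constructor <;> linarith [ha.1, ha.2, hb.1, hb.2])
  have hu := Real.sq_sqrt (show (0 : ℝ) ≤ 1 + a ^ 2 by positivity)
  have hv := Real.sq_sqrt (show (0 : ℝ) ≤ 1 + b ^ 2 by positivity)
  have hs := Real.sq_sqrt (show (0 : ℝ) ≤ 1 + ((1 / 2 : ℝ) * (a + b)) ^ 2 by positivity)
  have hu0 := Real.sqrt_nonneg (1 + a ^ 2)
  have hv0 := Real.sqrt_nonneg (1 + b ^ 2)
  have hs0 := Real.sqrt_nonneg (1 + ((1 / 2 : ℝ) * (a + b)) ^ 2)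
  set u := √(1 + a ^ 2)
  set v := √(1 + b ^ 2)
  set s := √(1 + ((1 / 2 : ℝ) * (a + b)) ^ 2)
  -- Lagrange's identity: `(1 + a²)(1 + b²) - (1 + ab)² = (a - b)²`.
  have h1 : (a - b) ^ 2 = (u * v - 1 - a * b) * (u * v + 1 + a * b) := by
    have : (u * v) ^ 2 = (1 + a ^ 2) * (1 + b ^ 2) := by rw [mul_pow, hu, hv]
    nlinarith
  have h2 : 2 * (u * v - 1 - a * b) = (u + v - 2 * s) * (u + v + 2 * s) := by nlinarith
  have h3 : u * v ≤ (1 + M) ^ 2 := by nlinarith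
  have h4 : a * b ≤ M ^ 2 := by
    calc a * b ≤ |a| * |b| := by rw [← abs_mul]; exact le_abs_self _
      _ ≤ M * M := mul_le_mul ha hb (abs_nonneg _) hM
      _ = M ^ 2 := by ring
  have h5 : u * v + 1 + a * b ≤ 2 * (1 + M) ^ 2 := by nlinarith
  have h6 : u * v - 1 - a * b ≤ (u + v - 2 * s) * (2 * (1 + M)) := by nlinarith
  calc (a - b) ^ 2 = (u * v - 1 - a * b) * (u * v + 1 + a * b) := h1
    _ ≤ (u * v - 1 - a * b) * (2 * (1 + M) ^ 2) := by
        refine mul_le_mul_of_nonneg_left h5 ?_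
        have : 0 ≤ (u + v - 2 * s) * (u + v + 2 * s) := by positivity
        linarith
    _ ≤ ((u + v - 2 * s) * (2 * (1 + M))) * (2 * (1 + M) ^ 2) := by gcongr
    _ = _ := by ring

/-! ### Convergent selections in L¹ by convex minimisation -/

section L1

variable {Ω : Type*} [MeasurableSpace Ω] {μ : Measure Ω}

/-- The strictly convex functional `f ↦ ∫ √(1 + f²)` on `L¹`. -/
noncomputable def integralSqrt (f : Lp ℝ 1 μ) : ℝ := ∫ x, √(1 + (f x) ^ 2) ∂μ

lemma sqrt_one_add_sq_le (t : ℝ) : √(1 + t ^ 2) ≤ 1 + |t| := by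
  rw [Real.sqrt_le_left (by positivity)]
  nlinarith [sq_abs t, abs_nonneg t]

lemma integrable_sqrt_one_add_sq [IsFiniteMeasure μ] (f : Lp ℝ 1 μ) :
    Integrable (fun x => √(1 + (f x) ^ 2)) μ := by
  refine ((integrable_const (1 : ℝ)).add (L1.integrable_coeFn f).abs).mono' ?_ ?_
  · have := (Lp.stronglyMeasurable f).measurable
    exact (by fun_prop : Measurable fun x => √(1 + (f x) ^ 2)).aestronglyMeasurable
  · filter_upwards with x
    rw [Real.norm_of_nonneg (Real.sqrt_nonneg _)]
    exact sqrt_one_add_sq_le _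

lemma integralSqrt_nonneg (f : Lp ℝ 1 μ) : 0 ≤ integralSqrt f :=
  integral_nonneg fun _ => Real.sqrt_nonneg _

lemma integralSqrt_le [IsFiniteMeasure μ] (f : Lp ℝ 1 μ) :
    integralSqrt f ≤ μ.real Set.univ + ‖f‖ := by
  have h := (L1.integrable_coeFn f).abs
  calc integralSqrt f ≤ ∫ x, (1 + |f x|) ∂μ :=
        integral_mono (integrable_sqrt_one_add_sq f) ((integrable_const 1).add h)
          fun x => sqrt_one_add_sq_le _
    _ = μ.real Set.univ + ‖f‖ := by
        rw [integral_add (integrable_const 1) h, L1.norm_eq_integral_norm]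
        simp

lemma integrable_sqrt_midpoint [IsFiniteMeasure μ] (f g : Lp ℝ 1 μ) :
    Integrable (fun x => √(1 + ((1 / 2 : ℝ) * (f x + g x)) ^ 2)) μ ∧
      ∫ x, √(1 + ((1 / 2 : ℝ) * (f x + g x)) ^ 2) ∂μ = integralSqrt ((1 / 2 : ℝ) • (f + g)) := by
  have h : (fun x => √(1 + ((((1 / 2 : ℝ) • (f + g) : Lp ℝ 1 μ)) x) ^ 2)) =ᵐ[μ]
      fun x => √(1 + ((1 / 2 : ℝ) * (f x + g x)) ^ 2) := by
    filter_upwards [Lp.coeFn_smul (1 / 2 : ℝ) (f + g), Lp.coeFn_add f g] with x h1 h2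
    rw [h1, Pi.smul_apply, h2, Pi.add_apply, smul_eq_mul]
  exact ⟨(integrable_sqrt_one_add_sq _).congr h, (integral_congr_ae h).symm⟩

lemma real_setOf_le_abs_le (f : Lp ℝ 1 μ) {M : ℝ} (hM : 0 < M) :
    μ.real {x | M ≤ |f x|} ≤ ‖f‖ / M := by
  rw [le_div_iff₀ hM, mul_comm, L1.norm_eq_integral_norm]
  exact mul_meas_ge_le_integral_of_nonneg (ae_of_all _ fun x => abs_nonneg _)
    (L1.integrable_coeFn f).abs M

/-- On bounded uniformly integrable subsets of `L¹`, the functional `integralSqrt` is uniformly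
convex. -/
lemma exists_gap_imp_norm_sub_le [IsFiniteMeasure μ] {S : Set (Lp ℝ 1 μ)} {C : ℝ}
    (hC : ∀ f ∈ S, ‖f‖ ≤ C)
    (hUI : ∀ ε : ℝ, 0 < ε → ∃ δ : ℝ, 0 < δ ∧ ∀ f ∈ S, ∀ E : Set Ω, MeasurableSet E →
      μ.real E < δ → ∫ x in E, |f x| ∂μ ≤ ε) {ε : ℝ} (hε : 0 < ε) :
    ∃ τ : ℝ, 0 < τ ∧ ∀ f ∈ S, ∀ g ∈ S,
      integralSqrt f + integralSqrt g - 2 * integralSqrt ((1 / 2 : ℝ) • (f + g)) ≤ τ →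
      ‖f - g‖ ≤ ε := by
  obtain ⟨δ, hδ, hS⟩ := hUI (ε / 4) (by positivity)
  -- By Markov, the two tails above M have total measure at most `2|C|/M < δ`.
  set M : ℝ := 2 * |C| / δ + 1 with hM
  have hM0 : 0 < M := by positivity
  set η : ℝ := ε / (4 * (μ.real Set.univ + 1)) with hη
  have hη0 : 0 < η := by positivity
  set K : ℝ := 4 * (1 + M) ^ 3 with hK
  have hK0 : 0 < K := by positivity
  -- The budget is ε/4 each for the constant η, the gap weighted by `K / η`, and the tails of f and
  -- g.
  refine ⟨ε * η / (4 * K), by positivity, fun f hf g hg hgap => ?_⟩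
  set E : Set Ω := {x | M ≤ |f x|} ∪ {x | M ≤ |g x|} with hE
  have hfm := (Lp.stronglyMeasurable f).measurable
  have hgm := (Lp.stronglyMeasurable g).measurable
  have hEm : MeasurableSet E :=
    (measurableSet_le measurable_const hfm.abs).union (measurableSet_le measurable_const hgm.abs)
  have hμE : μ.real E < δ := by
    have h1 : ∀ h ∈ S, μ.real {x | M ≤ |h x|} ≤ |C| / M := fun h hh =>
      (real_setOf_le_abs_le h hM0).trans (by gcongr; exact (hC h hh).trans (le_abs_self C))
    calc μ.real E ≤ |C| / M + |C| / M :=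
          (measureReal_union_le _ _).trans (add_le_add (h1 f hf) (h1 g hg))
      _ = 2 * |C| / M := by ring
      _ < δ := by
          rw [div_lt_iff₀ hM0, hM, mul_add, mul_div_cancel₀ _ hδ.ne']
          linarith
  have hfi := (L1.integrable_coeFn f).abs
  have hgi := (L1.integrable_coeFn g).abs
  obtain ⟨hmi, hme⟩ := integrable_sqrt_midpoint f g
  have hai : Integrable (fun x => √(1 + (f x) ^ 2) + √(1 + (g x) ^ 2)) μ :=
    (integrable_sqrt_one_add_sq f).add (integrable_sqrt_one_add_sq g)
  have hsi : Integrable (fun x => K / η * (√(1 + (f x) ^ 2) + √(1 + (g x) ^ 2) -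
      2 * √(1 + ((1 / 2 : ℝ) * (f x + g x)) ^ 2))) μ :=
    (hai.sub (hmi.const_mul 2)).const_mul _
  have hηi : Integrable (fun x => η + K / η * (√(1 + (f x) ^ 2) + √(1 + (g x) ^ 2) -
      2 * √(1 + ((1 / 2 : ℝ) * (f x + g x)) ^ 2))) μ := (integrable_const η).add hsi
  have hsub : ‖f - g‖ = ∫ x, |f x - g x| ∂μ := by
    rw [L1.norm_eq_integral_norm]
    refine integral_congr_ae ?_
    filter_upwards [Lp.coeFn_sub f g] with x hx
    rw [hx, Pi.sub_apply, Real.norm_eq_abs]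
  have hpt : ∀ x, |f x - g x| ≤ η + K / η * ((√(1 + (f x) ^ 2) + √(1 + (g x) ^ 2)) -
      2 * √(1 + ((1 / 2 : ℝ) * (f x + g x)) ^ 2)) +
      E.indicator (fun x => |f x| + |g x|) x := by
    intro x
    by_cases hx : x ∈ E
    · rw [Set.indicator_of_mem hx]
      have h1 := mul_nonneg (div_pos hK0 hη0).le (sqrt_one_add_sq_gap_nonneg (f x) (g x))
      have h2 := abs_sub (f x) (g x)
      linarith
    · rw [Set.indicator_of_notMem hx, add_zero]
      have hx' : |f x| ≤ M ∧ |g x| ≤ M := by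
        simp only [hE, Set.mem_union, Set.mem_ofPred_eq, not_or, not_le] at hx
        exact ⟨hx.1.le, hx.2.le⟩
      have h1 := sq_sub_le_mul_sqrt_one_add_sq_gap hM0.le hx'.1 hx'.2
      rw [← sq_abs] at h1
      have h2 : |f x - g x| ≤ η + |f x - g x| ^ 2 / η := by
        have : η + |f x - g x| ^ 2 / η - |f x - g x| =
          ((η - |f x - g x| / 2) ^ 2 + 3 / 4 * |f x - g x| ^ 2) / η := by
            field_simp
            ring
        have h3 : 0 ≤ ((η - |f x - g x| / 2) ^ 2 + 3 / 4 * |f x - g x| ^ 2) / η := by positivity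
        linarith
      refine h2.trans ?_
      rw [div_mul_eq_mul_div]
      gcongr
  have hind : Integrable (E.indicator fun x => |f x| + |g x|) μ := (hfi.add hgi).indicator hEm
  rw [hsub]
  calc ∫ x, |f x - g x| ∂μ
      ≤ ∫ x, (η + K / η * ((√(1 + (f x) ^ 2) + √(1 + (g x) ^ 2)) -
          2 * √(1 + ((1 / 2 : ℝ) * (f x + g x)) ^ 2)) +
          E.indicator (fun x => |f x| + |g x|) x) ∂μ :=
        integral_mono ((L1.integrable_coeFn f).sub (L1.integrable_coeFn g)).abs
          (hηi.add hind) hpt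
    _ = μ.real Set.univ * η + K / η * (integralSqrt f + integralSqrt g -
          2 * integralSqrt ((1 / 2 : ℝ) • (f + g))) +
          (∫ x in E, |f x| ∂μ + ∫ x in E, |g x| ∂μ) := by
        rw [integral_add hηi hind, integral_add (integrable_const η) hsi, integral_const_mul,
          integral_sub hai (hmi.const_mul 2),
          integral_add (integrable_sqrt_one_add_sq f) (integrable_sqrt_one_add_sq g),
          integral_const_mul, hme, integral_indicator hEm,
          integral_add hfi.integrableOn hgi.integrableOn]
        simp [integralSqrt]
    _ ≤ ε / 4 + K / η * (ε * η / (4 * K)) + (ε / 4 + ε / 4) := by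
        gcongr
        · rw [hη, mul_div_assoc', div_le_div_iff₀ (by positivity) (by norm_num)]
          nlinarith [measureReal_nonneg (μ := μ) (s := Set.univ)]
        · exact hS f hf E hEm hμE
        · exact hS g hg E hEm hμE
    _ = ε := by
        field_simp
        ring

/-- A decreasing sequence of nonempty convex sets in `L¹`, the first of which is bounded and
uniformly integrable, admits a norm convergent selection. -/
theorem exists_tendsto_of_antitone_convex [IsFiniteMeasure μ] {S : ℕ → Set (Lp ℝ 1 μ)}
    (hanti : Antitone S) (hconv : ∀ n, Convex ℝ (S n)) (hne : ∀ n, (S n).Nonempty) {C : ℝ}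
    (hC : ∀ f ∈ S 0, ‖f‖ ≤ C)
    (hUI : ∀ ε : ℝ, 0 < ε → ∃ δ : ℝ, 0 < δ ∧ ∀ f ∈ S 0, ∀ E : Set Ω, MeasurableSet E →
      μ.real E < δ → ∫ x in E, |f x| ∂μ ≤ ε) :
    ∃ g : ℕ → Lp ℝ 1 μ, (∀ n, g n ∈ S n) ∧ ∃ f, Tendsto g atTop (𝓝 f) := by
  set m : ℕ → ℝ := fun n => sInf (integralSqrt '' S n) with hm
  have hbdd : ∀ n, BddBelow (integralSqrt '' S n) := fun n =>
    ⟨0, by rintro _ ⟨f, -, rfl⟩; exact integralSqrt_nonneg f⟩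
  have hex : ∀ n : ℕ, ∃ g ∈ S n, integralSqrt g < m n + 1 / ((n : ℝ) + 1) := fun n => by
    obtain ⟨_, ⟨g, hg, rfl⟩, h⟩ := exists_lt_of_csInf_lt ((hne n).image integralSqrt)
      (lt_add_of_pos_right (m n) (by positivity : 0 < 1 / ((n : ℝ) + 1)))
    exact ⟨g, hg, h⟩
  choose g hg hgm using hex
  refine ⟨g, hg, cauchySeq_tendsto_of_complete ?_⟩
  have hmono : Monotone m := fun i j hij =>
    csInf_le_csInf (hbdd i) ((hne j).image _) (Set.image_mono (hanti hij))
  have habove : BddAbove (Set.range m) := by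
    refine ⟨μ.real Set.univ + C, ?_⟩
    rintro _ ⟨n, rfl⟩
    exact (csInf_le (hbdd n) ⟨g n, hg n, rfl⟩).trans ((integralSqrt_le _).trans
      (by gcongr; exact hC _ (hanti (Nat.zero_le n) (hg n))))
  have hlim := tendsto_atTop_ciSup hmono habove
  set L := ⨆ n, m n
  have hgap0 : Tendsto (fun N : ℕ => 2 * L + 2 * (1 / ((N : ℝ) + 1)) - 2 * m N) atTop (𝓝 0) := by
    have := ((tendsto_one_div_add_atTop_nhds_zero_nat (𝕜 := ℝ)).const_mul 2).const_add (2 * L)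
    simpa using this.sub (hlim.const_mul 2)
  have hgap : ∀ N i j : ℕ, N ≤ i → N ≤ j → integralSqrt (g i) + integralSqrt (g j) -
      2 * integralSqrt ((1 / 2 : ℝ) • (g i + g j)) ≤ 2 * L + 2 * (1 / ((N : ℝ) + 1)) - 2 * m N := by
    intro N i j hi hj
    have key : ∀ i : ℕ, N ≤ i → integralSqrt (g i) ≤ L + 1 / ((N : ℝ) + 1) := fun i hi =>
      (hgm i).le.trans (add_le_add (le_ciSup habove i) (Nat.one_div_le_one_div hi))
    -- Midpoints stay in the convex set `S N`, so almost minimisers have small convexity gap.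
    have hmid : m N ≤ integralSqrt ((1 / 2 : ℝ) • (g i + g j)) := by
      refine csInf_le (hbdd N) ⟨_, ?_, rfl⟩
      rw [smul_add]
      exact hconv N (hanti hi (hg i)) (hanti hj (hg j)) (by norm_num) (by norm_num) (by norm_num)
    linarith [key i hi, key j hj]
  rw [Metric.cauchySeq_iff]
  intro ε hε
  obtain ⟨τ, hτ, hτS⟩ := exists_gap_imp_norm_sub_le hC hUI (half_pos hε)
  obtain ⟨N, hN⟩ := (hgap0.eventually_le_const hτ).exists
  refine ⟨N, fun i hi j hj => ?_⟩
  rw [dist_eq_norm]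
  exact (hτS _ (hanti (Nat.zero_le i) (hg i)) _ (hanti (Nat.zero_le j) (hg j))
    ((hgap N i j hi hj).trans hN)).trans_lt (half_lt_self hε)

end L1

/-! ### Scalar densities of the vector measure -/

section Density

variable {Ω : Type*} [MeasurableSpace Ω] {μ : Measure Ω}
  {Z : Type*} [NormedAddCommGroup Z] [NormedSpace ℝ Z]
  {ν : VectorMeasure Ω (StrongDual ℝ Z)}

lemma IsContinuousWrt.eq_zero_of_measure_eq_zero {E : Type*} [NormedAddCommGroup E]
    {ν : VectorMeasure Ω E} (hν : IsContinuousWrt ν μ) {A : Set Ω}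
    (hA : MeasurableSet A) (hμ : μ A = 0) : ν A = 0 := by
  rw [← norm_le_zero_iff]
  refine le_of_forall_pos_lt_add fun ε hε => ?_
  obtain ⟨δ, hδ, h⟩ := hν ε hε
  rw [zero_add]
  exact h A hA (by simpa [Measure.real, hμ] using hδ)

/-- The Radon-Nikodym densities of the scalar measures `A ↦ ν A z`, as a linear map into `L¹`. -/
theorem IsContinuousWrt.exists_density [IsFiniteMeasure μ] (hν : IsContinuousWrt ν μ) :
    ∃ T : Z →ₗ[ℝ] Lp ℝ 1 μ, ∀ z, ∀ A, MeasurableSet A → ∫ x in A, T z x ∂μ = ν A z := by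
  have hex : ∀ z : Z, ∃ f : Lp ℝ 1 μ, ∀ A, MeasurableSet A → ∫ x in A, f x ∂μ = ν A z := by
    intro z
    have hcont : Continuous fun φ : StrongDual ℝ Z => φ z := continuous_eval_const z
    let s : SignedMeasure Ω := ν.mapRange
      (⟨⟨fun φ => φ z, rfl⟩, fun _ _ => rfl⟩ : StrongDual ℝ Z →+ ℝ) hcont
    have hs : ∀ A, s A = ν A z := fun A => VectorMeasure.mapRange_apply _ _
    have hac : s ≪ᵥ μ.toENNRealVectorMeasure := by
      refine VectorMeasure.AbsolutelyContinuous.mk fun A hA hμA => ?_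
      rw [Measure.toENNRealVectorMeasure_apply_measurable hA] at hμA
      rw [hs, hν.eq_zero_of_measure_eq_zero hA hμA]
      rfl
    have hint := s.integrable_rnDeriv μ
    refine ⟨hint.toL1 _, fun A hA => ?_⟩
    rw [setIntegral_congr_ae hA (hint.coeFn_toL1.mono fun x hx _ => hx),
      ← withDensityᵥ_apply hint hA, s.withDensityᵥ_rnDeriv_eq μ hac, hs]
  choose T hT using hex
  have huniq : ∀ f g : Lp ℝ 1 μ, (∀ A, MeasurableSet A → ∫ x in A, f x ∂μ = ∫ x in A, g x ∂μ) →
      f = g := fun f g h => Lp.ext (Integrable.ae_eq_of_forall_setIntegral_eq _ _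
    (L1.integrable_coeFn f) (L1.integrable_coeFn g) fun A hA _ => h A hA)
  refine ⟨⟨⟨T, fun z w => huniq _ _ fun A hA => ?_⟩, fun c z => huniq _ _ fun A hA => ?_⟩, hT⟩
  · rw [setIntegral_congr_ae hA ((Lp.coeFn_add (T z) (T w)).mono fun x hx _ => hx)]
    simp only [Pi.add_apply]
    rw [integral_add (L1.integrable_coeFn _).integrableOn (L1.integrable_coeFn _).integrableOn,
      hT _ A hA, hT _ A hA, hT _ A hA, map_add]
  · rw [setIntegral_congr_ae hA ((Lp.coeFn_smul (RingHom.id ℝ c) (T z)).mono fun x hx _ => hx)]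
    simp only [Pi.smul_apply]
    rw [integral_smul, hT _ A hA, hT _ A hA, map_smul]
    rfl

/-- Splitting E by the sign of the density gives two values of `ν`, hence the factor 2. Taking E to
be the whole space gives L¹ bounds; small E gives uniform integrability. -/
lemma setIntegral_abs_density_le {T : Z →ₗ[ℝ] Lp ℝ 1 μ}
    (hT : ∀ z, ∀ A, MeasurableSet A → ∫ x in A, T z x ∂μ = ν A z) {E : Set Ω}
    (hE : MeasurableSet E) {b : ℝ} (hb : ∀ F ⊆ E, MeasurableSet F → ‖ν F‖ ≤ b) (z : Z) :
    ∫ x in E, |T z x| ∂μ ≤ 2 * b * ‖z‖ := by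
  have hi := L1.integrable_coeFn (T z)
  set P : Set Ω := {x | 0 ≤ T z x} with hP
  have hPm : MeasurableSet P :=
    measurableSet_le measurable_const (Lp.stronglyMeasurable (T z)).measurable
  have hle : ∀ F ⊆ E, MeasurableSet F → |ν F z| ≤ b * ‖z‖ := fun F hF hFm =>
    ((ν F).le_opNorm z).trans (by gcongr; exact hb F hF hFm)
  have h1 : ∫ x in E ∩ P, |T z x| ∂μ = ν (E ∩ P) z := by
    rw [← hT z _ (hE.inter hPm)]
    exact setIntegral_congr_fun (hE.inter hPm) fun x hx => abs_of_nonneg hx.2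
  have h2 : ∫ x in E \ P, |T z x| ∂μ = -ν (E \ P) z := by
    rw [← hT z _ (hE.diff hPm), ← integral_neg]
    exact setIntegral_congr_fun (hE.diff hPm) fun x hx => abs_of_neg (not_le.1 hx.2)
  rw [← integral_inter_add_sdiff hPm hi.abs.integrableOn, h1, h2]
  have h3 := (le_abs_self _).trans (hle _ Set.inter_subset_left (hE.inter hPm))
  have h4 := (neg_le_abs _).trans (hle _ Set.sdiff_subset (hE.diff hPm))
  linarith

/-- A vector measure with values in the dual of a Banach space and with integrable densities has
bounded range. -/
lemma exists_norm_le_of_density [CompleteSpace Z] {T : Z →ₗ[ℝ] Lp ℝ 1 μ}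
    (hT : ∀ z, ∀ A, MeasurableSet A → ∫ x in A, T z x ∂μ = ν A z) :
    ∃ b : ℝ, ∀ A, MeasurableSet A → ‖ν A‖ ≤ b := by
  obtain ⟨b, hb⟩ := banach_steinhaus (g := fun A : {A : Set Ω // MeasurableSet A} => ν A) fun z =>
    ⟨∫ x, ‖T z x‖ ∂μ, fun A => by
      rw [← hT z A A.2]
      exact (norm_integral_le_integral_norm _).trans (setIntegral_le_integral
        (L1.integrable_coeFn (T z)).norm (ae_of_all _ fun x => norm_nonneg _))⟩
  exact ⟨b, fun A hA => hb ⟨A, hA⟩⟩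

end Density

/-- A function with positive integral over `A` which is the a.e. limit of a sequence has a
positive measure subset of `A` on which the sequence is eventually bounded below by a positive
constant. -/
lemma exists_measurableSet_forall_le_of_tendsto_ae {Ω : Type*} [MeasurableSpace Ω] {μ : Measure Ω}
    {g : ℕ → Ω → ℝ} {f : Ω → ℝ} (hg : ∀ n, Measurable (g n))
    (hlim : ∀ᵐ x ∂μ, Tendsto (fun n => g n x) atTop (𝓝 (f x))) {A : Set Ω}
    (hA : MeasurableSet A) (hpos : 0 < ∫ x in A, f x ∂μ) :
    ∃ N : ℕ, ∃ δ : ℝ, 0 < δ ∧ ∃ B ⊆ A, MeasurableSet B ∧ 0 < μ B ∧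
      ∀ n, N ≤ n → ∀ x ∈ B, δ ≤ g n x := by
  -- Almost every point of A with `f > 0` lies in some `B N`, so if all were null the integral of f
  -- could not be positive.
  set B : ℕ → Set Ω := fun N => A ∩ ⋂ n, ⋂ (_ : N ≤ n), {x | 1 / ((N : ℝ) + 1) ≤ g n x} with hB
  have hBm : ∀ N, MeasurableSet (B N) := fun N => hA.inter
    (MeasurableSet.iInter fun n => MeasurableSet.iInter fun _ =>
      measurableSet_le measurable_const (hg n))
  obtain ⟨N, hN⟩ : ∃ N, 0 < μ (B N) := by
    by_contra! h
    have hnull : μ (⋃ N, B N) = 0 := measure_iUnion_null fun N => nonpos_iff_eq_zero.1 (h N)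
    refine hpos.not_ge (setIntegral_nonpos_of_ae_restrict ?_)
    rw [EventuallyLE, ae_restrict_iff' hA]
    filter_upwards [hlim, measure_eq_zero_iff_ae_notMem.1 hnull] with x hx hxB hxA
    by_contra! hfx
    refine hxB ?_
    obtain ⟨k, hk⟩ := exists_nat_one_div_lt (half_pos hfx)
    obtain ⟨n, hn⟩ := eventually_atTop.1 (hx.eventually_const_le (half_lt_self hfx))
    refine Set.mem_iUnion.2 ⟨max k n, hxA, ?_⟩
    simp only [Set.mem_iInter]
    intro i hi
    exact ((Nat.one_div_le_one_div (le_max_left k n)).trans hk.le).trans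
      (hn i ((le_max_right k n).trans hi))
  refine ⟨N, 1 / ((N : ℝ) + 1), by positivity, B N, Set.inter_subset_left, hBm N, hN, ?_⟩
  rintro n hn x ⟨-, hx⟩
  exact Set.mem_iInter₂.1 hx n hn

/-! ### Sequential continuity from condition (G) -/

section Main

variable {Ω : Type*} [MeasurableSpace Ω] {μ : Measure Ω}
  {Z : Type*} [NormedAddCommGroup Z] [NormedSpace ℝ Z]
  {ν : VectorMeasure Ω (StrongDual ℝ Z)} {X : Submodule ℝ (StrongDual ℝ Z)}

/-- Forward convex combinations of a sequence converge to the same limit. -/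
lemma tendsto_zero_of_mem_convexHull {z w : ℕ → Z} (hw : ∀ n, w n ∈ convexHull ℝ (z '' Set.Ici n))
    {x : StrongDual ℝ Z} (hz : Tendsto (fun n => x (z n)) atTop (𝓝 0)) :
    Tendsto (fun n => x (w n)) atTop (𝓝 0) := by
  rw [Metric.tendsto_atTop] at hz ⊢
  intro ε hε
  obtain ⟨N, hN⟩ := hz ε hε
  refine ⟨N, fun n hn => ?_⟩
  have hconv : Convex ℝ (x ⁻¹' Metric.ball 0 ε) :=
    (convex_ball (0 : ℝ) ε).linear_preimage x.toLinearMap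
  refine convexHull_min ?_ hconv (hw n)
  rintro _ ⟨k, hk, rfl⟩
  exact hN k (hn.trans hk)

/-- Lower bounds of the averages of `ν` on `A` at a point persist in the weak* closed convex hull
of the average range. -/
lemma le_apply_of_mem_closure_averageRange {A : Set Ω} {z : Z} {δ : ℝ}
    (h : ∀ B ⊆ A, MeasurableSet B → 0 < μ B → δ ≤ (μ.real B)⁻¹ * ν B z) {x : StrongDual ℝ Z}
    (hx : StrongDual.toWeakDual x ∈
      closure (StrongDual.toWeakDual '' (convexHull ℝ (averageRange ν μ A)))) : δ ≤ x z := by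
  have hcl : IsClosed {y : WeakDual ℝ Z | δ ≤ y z} :=
    isClosed_le continuous_const (WeakDual.eval_continuous z)
  refine closure_minimal ?_ hcl hx
  rintro _ ⟨y, hy, rfl⟩
  have hconv : Convex ℝ {y : StrongDual ℝ Z | δ ≤ y z} :=
    convex_halfSpace_ge (f := fun y : StrongDual ℝ Z => y z)
      ⟨fun _ _ => rfl, fun _ _ => rfl⟩ δ
  refine convexHull_min ?_ hconv hy
  rintro _ ⟨B, hB, hBA, hpos, rfl⟩
  exact h B hBA hB hpos

theorem ConditionG.not_forall_le [IsFiniteMeasure μ] [CompleteSpace Z] (hν : IsContinuousWrt ν μ)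
    (hG : ConditionG ν μ X) {z : ℕ → Z} {R : ℝ} (hR : ∀ n, ‖z n‖ ≤ R)
    (hz : ∀ x ∈ X, Tendsto (fun n => x (z n)) atTop (𝓝 0)) {A : Set Ω} (hA : MeasurableSet A)
    {ε : ℝ} (hε : 0 < ε) : ¬ ∀ n, ε ≤ ν A (z n) := by
  intro hle
  obtain ⟨T, hT⟩ := hν.exists_density
  obtain ⟨b, hb⟩ := exists_norm_le_of_density hT
  have hR0 : 0 ≤ R := (norm_nonneg _).trans (hR 0)
  have hb0 : 0 ≤ b := (norm_nonneg _).trans (hb ∅ MeasurableSet.empty)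
  have hball : ∀ n, ∀ w ∈ convexHull ℝ (z '' Set.Ici n), ‖w‖ ≤ R := fun n w hw => by
    have : convexHull ℝ (z '' Set.Ici n) ⊆ Metric.closedBall 0 R := by
      refine convexHull_min ?_ (convex_closedBall _ _)
      rintro _ ⟨k, -, rfl⟩
      simpa using hR k
    simpa using this hw
  obtain ⟨g, hg, f, hf⟩ := exists_tendsto_of_antitone_convex
    (S := fun n => T '' convexHull ℝ (z '' Set.Ici n)) (C := 2 * b * R)
    (fun i j hij => Set.image_mono (convexHull_mono (Set.image_mono (Set.Ici_subset_Ici.2 hij))))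
    (fun n => (convex_convexHull ℝ _).linear_image T)
    (fun n => ((Set.nonempty_Ici.image z).convexHull).image T)
    (by
      rintro _ ⟨w, hw, rfl⟩
      have := setIntegral_abs_density_le hT MeasurableSet.univ (fun F _ hF => hb F hF) w
      rw [Measure.restrict_univ] at this
      rw [L1.norm_eq_integral_norm]
      exact this.trans (by gcongr; exact hball 0 w hw))
    (by
      intro ε hε
      -- `R + 1` rather than R, since R may be zero.
      obtain ⟨δ, hδ, h⟩ := hν (ε / (2 * (R + 1))) (by positivity)
      refine ⟨δ, hδ, ?_⟩
      rintro _ ⟨w, hw, rfl⟩ E hE hμE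
      refine (setIntegral_abs_density_le hT hE
        (fun F hF hFm => (h F hFm ((measureReal_mono hF).trans_lt hμE)).le) w).trans ?_
      calc 2 * (ε / (2 * (R + 1))) * ‖w‖ ≤ 2 * (ε / (2 * (R + 1))) * (R + 1) := by
            gcongr
            linarith [hball 0 w hw]
        _ = ε := by field_simp)
  choose w hw hwg using hg
  have hfA : ε ≤ ∫ x in A, f x ∂μ := by
    refine ge_of_tendsto (((continuous_setIntegral A).tendsto f).comp hf) (.of_forall fun n => ?_)
    have : convexHull ℝ (z '' Set.Ici n) ⊆ {w : Z | ε ≤ ν A w} := by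
      refine convexHull_min ?_ (convex_halfSpace_ge (ν A).toLinearMap.isLinear ε)
      rintro _ ⟨k, -, rfl⟩
      exact hle k
    change ε ≤ ∫ x in A, g n x ∂μ
    rw [← hwg n, hT _ A hA]
    exact this (hw n)
  obtain ⟨ns, hns, hae⟩ := (tendstoInMeasure_of_tendsto_Lp hf).exists_seq_tendsto_ae
  obtain ⟨N, δ, hδ, B, hBA, hB, hμB, hge⟩ := exists_measurableSet_forall_le_of_tendsto_ae
    (fun n => (Lp.stronglyMeasurable (g (ns n))).measurable) hae hA (hε.trans_le hfA)
  -- One x, independent of n, inherits the lower bound δ at every late `w (ns n)`.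
  obtain ⟨x, hxX, hx⟩ := hG B hB hμB
  have hlow : ∀ n, N ≤ n → δ ≤ x (w (ns n)) := fun n hn =>
    le_apply_of_mem_closure_averageRange (fun F hFB hF hμF => by
      have hF0 : 0 < μ.real F := ENNReal.toReal_pos hμF.ne' (measure_ne_top μ F)
      rw [← hT _ F hF, hwg, ← div_eq_inv_mul, le_div_iff₀ hF0, mul_comm]
      calc μ.real F * δ = ∫ _ in F, δ ∂μ := by simp
        _ ≤ ∫ x in F, g (ns n) x ∂μ := setIntegral_mono_on (by simp)
            (L1.integrable_coeFn _).integrableOn hF fun x hx => hge n hn x (hFB hx)) hx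
  have hlim := (tendsto_zero_of_mem_convexHull hw (hz x hxX)).comp hns.tendsto_atTop
  exact hδ.not_ge (ge_of_tendsto hlim (eventually_atTop.2 ⟨N, hlow⟩))

/-- Passing to a subsequence and multiplying by signs preserves the hypotheses on `z` and reduces
failure of convergence to a one-sided bound. -/
theorem ConditionG.tendsto_apply_zero [IsFiniteMeasure μ] [CompleteSpace Z]
    (hν : IsContinuousWrt ν μ) (hG : ConditionG ν μ X) {z : ℕ → Z} {R : ℝ} (hR : ∀ n, ‖z n‖ ≤ R)
    (hz : ∀ x ∈ X, Tendsto (fun n => x (z n)) atTop (𝓝 0)) {A : Set Ω} (hA : MeasurableSet A) :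
    Tendsto (fun n => ν A (z n)) atTop (𝓝 0) := by
  by_contra hnot
  obtain ⟨ε, hε, hfreq⟩ : ∃ ε > 0, ∃ᶠ n in atTop, ε ≤ |ν A (z n)| := by
    simpa [Metric.tendsto_nhds, Filter.Frequently] using hnot
  obtain ⟨φ, hφ, hφε⟩ := extraction_of_frequently_atTop hfreq
  set σ : ℕ → ℝ := fun n => SignType.sign (ν A (z (φ n)))
  have hσ : ∀ n, |σ n| ≤ 1 := fun n => by
    rcases SignType.trichotomy (SignType.sign (ν A (z (φ n)))) with h | h | h <;> simp [σ, h]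
  refine hG.not_forall_le hν (z := fun n => σ n • z (φ n)) (R := R) (fun n => ?_)
    (fun x hx => ?_) hA hε fun n => ?_
  · rw [norm_smul]
    exact (mul_le_of_le_one_left (norm_nonneg _) (hσ n)).trans (hR _)
  · refine squeeze_zero_norm (fun n => ?_)
      (tendsto_zero_iff_norm_tendsto_zero.1 ((hz x hx).comp hφ.tendsto_atTop))
    rw [map_smul, norm_smul]
    exact mul_le_of_le_one_left (norm_nonneg _) (hσ n)
  · rw [map_smul, smul_eq_mul, sign_mul_self]
    exact hφε n

/-- A sequence of points of `Z` that is pointwise bounded on a Banach space `E` of functionals is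
uniformly bounded on the unit ball of `E`. -/
lemma exists_apply_le_of_bddAbove {E : Type*} [NormedAddCommGroup E] [NormedSpace ℝ E]
    [CompleteSpace E] (J : E →ₗᵢ[ℝ] StrongDual ℝ Z) {z : ℕ → Z}
    (hz : ∀ e, BddAbove (Set.range fun n => ‖J e (z n)‖)) :
    ∃ C, ∀ n e, ‖e‖ ≤ 1 → J e (z n) ≤ C := by
  let ev : ℕ → StrongDual ℝ E := fun n => J.toContinuousLinearMap.flip (z n)
  obtain ⟨C, hC⟩ := banach_steinhaus (g := ev) fun e => by
    obtain ⟨C, hC⟩ := hz e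
    exact ⟨C, fun n => hC ⟨n, rfl⟩⟩
  refine ⟨C, fun n e he => (le_abs_self _).trans (((ev n).le_of_opNorm_le (hC n) e).trans ?_)⟩
  exact mul_le_of_le_one_right ((norm_nonneg _).trans (hC n)) he

/-- Sequences converging pointwise to zero on a closed norming subspace are bounded. -/
lemma IsNorming.exists_norm_le (hX : IsNorming X)
    (hcl : IsClosed (X : Set (StrongDual ℝ Z))) {z : ℕ → Z}
    (hz : ∀ x ∈ X, Tendsto (fun n => x (z n)) atTop (𝓝 0)) : ∃ R, ∀ n, ‖z n‖ ≤ R := by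
  have : CompleteSpace X := hcl.completeSpace_coe
  obtain ⟨c, hc, _, -, hnorm⟩ := hX
  obtain ⟨C, hC⟩ := exists_apply_le_of_bddAbove (E := X) X.subtypeₗᵢ (z := z) fun x : X =>
    (hz x x.2).norm.bddAbove_range
  refine ⟨C / c, fun n => ?_⟩
  rw [le_div_iff₀ hc, mul_comm]
  refine (hnorm (z n)).1.trans (csSup_le ⟨0, 0, X.zero_mem, by simp, by simp⟩ ?_)
  rintro _ ⟨x, hx, hx1, rfl⟩
  exact hC n ⟨x, hx⟩ hx1

end Main

theorem theorem1 {Ω : Type*} [MeasurableSpace Ω] (μ : Measure Ω) [IsFiniteMeasure μ]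
    {Z : Type*} [NormedAddCommGroup Z] [NormedSpace ℝ Z] [CompleteSpace Z]
    (X : Submodule ℝ (StrongDual ℝ Z))
    (hX_closed : IsClosed (X : Set (StrongDual ℝ Z)))
    (hX_norming : IsNorming X)
    (hMazur : HasMazurProperty (WeakBilin (dualPairing X)))
    (ν : VectorMeasure Ω (StrongDual ℝ Z))
    (hν_cont : IsContinuousWrt ν μ)
    (hG : ConditionG ν μ X) :
    ∀ A : Set Ω, MeasurableSet A → ν A ∈ X := by
  intro A hA
  let φ : WeakBilin (dualPairing X) →ₗ[ℝ] ℝ := (ν A).toLinearMap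
  have hφ : Continuous φ := hMazur φ fun u p hup => by
    let z : ℕ → Z := fun n => u n
    let q : Z := p
    have hz : ∀ x ∈ X, Tendsto (fun n => x (z n - q)) atTop (𝓝 0) := fun x hx => by
      have h : Tendsto (fun n => x (z n)) atTop (𝓝 (x q)) :=
        ((WeakBilin.eval_continuous (dualPairing X) ⟨x, hx⟩).tendsto p).comp hup
      simpa using h.sub_const (x q)
    obtain ⟨R, hR⟩ := hX_norming.exists_norm_le hX_closed hz
    have h := (hG.tendsto_apply_zero hν_cont hR hz hA).add_const (ν A q)
    simp only [map_sub, sub_add_cancel, zero_add] at h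
    exact h
  let Φ : StrongDual ℝ (WeakBilin (dualPairing X)) := ⟨φ, hφ⟩
  -- The dual of Z under σ(Z,X) is X itself.
  obtain ⟨x, hx⟩ :=
    LinearMap.dualEmbedding_surjective (𝕜 := ℝ) (E := Z) (F := X) (dualPairing X) Φ
  have : ν A = x := ContinuousLinearMap.ext fun z => (DFunLike.congr_fun hx z).symm
  rw [this]
  exact x.2
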